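/- Let $\mathbb{C}$ be a regular category, i.e. a category with finite limits in which every morphism factors as a regular epimorphism followed by a monomorphism and in which regular epimorphisms are stable under pullback. A relation on an object $X$ is a subobject $\langle r_1,r_2\rangle\colon R\rightarrowtail X\times X$; relations are ordered as subobjects, $R\wedge S$ denotes the intersection, $R^\circ=\langle r_2,r_1\rangle$ the opposite relation, and $SR$ (first $R$, then $S$) the relational composite, i.e. the image of $\langle r_1\pi_1,s_2\pi_2\rangle\colon R\times_X S\to X\times X$, where $\pi_1,\pi_2$ are the projections of the pullback of $r_2$ and $s_1$. A relation $R$ on $X$ is reflexive if $1_X\leqslant R$, where $1_X$ is the diagonal $\langle 1_X,1_X\rangle\colon X\rightarrowtail X\times X$, and it is an equivalence relation if moreover $R^\circ\leqslant R$ and $RR\leqslant R$. For generalized elements $x,y\colon W\to X$, write $(x,y)\in R$ if $\langle x,y\rangle\colon W\to X\times X$ factors through $R$. Suppose that $\mathbb{C}$ is a Goursat category, i.e. $RSR=SRS$ for any two equivalence relations $R,S$ on the same object of $\mathbb{C}$. Then the Shifting Lemma holds in $\mathbb{C}$ when $S$ is a reflexive relation and $R$ and $T$ are equivalence relations: let $R$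 and $T$ be equivalence relations and $S$ a reflexive relation on an object $X$ of $\mathbb{C}$ such that $R\wedge S\leqslant T$. Then for every object $W$ and all morphisms $x,y,u,v\colon W\to X$ with $$(x,y)\in R\wedge T,\qquad (x,u)\in S,\qquad (y,v)\in S,\qquad (u,v)\in R,$$ one has $(u,v)\in T$. -/

import Mathlib

open CategoryTheory CategoryTheory.Limits

universe v u

noncomputable section

namespace RegularRel

variable {C : Type u} [Category.{v} C] [Regular C]

/-- An internal relation `⟨r₁, r₂⟩ : R ↣ X × Y` from `X` to `Y`. -/
abbrev Rel (X Y : C) : Type (max u v) := Subobject (X ⨯ Y)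

variable {X Y Z : C}

/-- The first projection `r₁ : R ⟶ X` of a relation from `X` to `Y`. -/
abbrev Rel.fst (R : Rel X Y) : (R : C) ⟶ X := R.arrow ≫ prod.fst

/-- The second projection `r₂ : R ⟶ Y` of a relation from `X` to `Y`. -/
abbrev Rel.snd (R : Rel X Y) : (R : C) ⟶ Y := R.arrow ≫ prod.snd

/-- Generalised elements `x : W ⟶ X` and `y : W ⟶ Y` are related by `R`, written `(x, y) ∈ R`:
the morphism `⟨x, y⟩ : W ⟶ X × Y` factors through `R`. -/
def Rel.Mem (R : Rel X Y) {W : C} (x : W ⟶ X) (y : W ⟶ Y) : Prop :=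
  R.Factors (prod.lift x y)

instance Rel.mono_lift_snd_fst (R : Rel X Y) : Mono (prod.lift R.snd R.fst) := by
  have h : prod.lift R.snd R.fst = R.arrow ≫ (prod.braiding X Y).hom := by
    ext <;> simp
  rw [h]
  infer_instance

/-- The opposite relation `R°`, given by `⟨r₂, r₁⟩ : R ↣ Y × X`. -/
def Rel.opposite (R : Rel X Y) : Rel Y X :=
  Subobject.mk (prod.lift R.snd R.fst)

/-- The relational composite `SR` (first `R`, then `S`): the image of
`⟨r₁ π₁, s₂ π₂⟩ : R ×_Y S ⟶ X × Z`. In a regular category images are given by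
(regular epimorphism, monomorphism) factorisations. -/
def Rel.comp (S : Rel Y Z) (R : Rel X Y) : Rel X Z :=
  imageSubobject (prod.lift (pullback.fst R.snd S.fst ≫ R.fst) (pullback.snd R.snd S.fst ≫ S.snd))

/-- `1_X ≤ R`, where `1_X` is the diagonal `⟨1_X, 1_X⟩ : X ↣ X × X`. -/
def Rel.IsReflexive (R : Rel X X) : Prop :=
  Subobject.mk (diag X) ≤ R

/-- `R° ≤ R`. -/
def Rel.IsSymmetric (R : Rel X X) : Prop :=
  R.opposite ≤ R

/-- `RR ≤ R`. -/
def Rel.IsTransitive (R : Rel X X) : Prop :=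
  Rel.comp R R ≤ R

/-- Internal equivalence relations on `X`. -/
structure Rel.IsEquivalence (R : Rel X X) : Prop where
  refl : R.IsReflexive
  symm : R.IsSymmetric
  trans : R.IsTransitive

variable (C) in
/-- A regular category is a Goursat category when it is 3-permutable: `RSR = SRS` for all
equivalence relations `R` and `S` on the same object. -/
def IsGoursat : Prop :=
  ∀ (X : C) (R S : Rel X X), R.IsEquivalence → S.IsEquivalence →
    Rel.comp R (Rel.comp S R) = Rel.comp S (Rel.comp R S)

end RegularRel

end

namespace RegularRel

open Subobject

variable {C : Type u} [Category.{v} C] [Regular C] {X Y Z : C}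

namespace Rel

section Elements

/-! The Goursat property is applied on the object `S` rather than on `X`. A pair in `S` whose
components are `R`-related is `T`-related, because `R ⊓ S ≤ T`. Reflexivity puts `(u, u)` and `(v,
v)` in `S`, and 3-permutability then links them through two pairs with a common second component
`b`; each outer link gives a `T`-relation to `b`, so `u T b T v`. The argument runs on generalised
elements: intermediate elements exist only on a cover (`Mem.exists_of_comp`), and the conclusion
descends (`Mem.of_strongEpi`). -/

theorem Mem.precomp {R : Rel X Y} {W W' : C} {x : W ⟶ X} {y : W ⟶ Y} (h : R.Mem x y)
    (p : W' ⟶ W) : R.Mem (p ≫ x) (p ≫ y) := by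
  have := factors_of_factors_right p h
  rwa [prod.comp_lift] at this

theorem lift_fst_snd (R : Rel X Y) : prod.lift R.fst R.snd = R.arrow := by
  rw [← prod.comp_lift, prod.lift_fst_snd, Category.comp_id]

theorem mem_fst_snd (R : Rel X Y) : R.Mem R.fst R.snd := by
  rw [Mem, lift_fst_snd]
  exact factors_self R

theorem Mem.exists_lift {R : Rel X Y} {W : C} {x : W ⟶ X} {y : W ⟶ Y} (h : R.Mem x y) :
    ∃ k : W ⟶ (R : C), k ≫ R.fst = x ∧ k ≫ R.snd = y := by
  rw [Mem] at h
  refine ⟨R.factorThru _ h, ?_, ?_⟩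
  · rw [factorThru_arrow_assoc, prod.lift_fst]
  · rw [factorThru_arrow_assoc, prod.lift_snd]

/-- Yoneda: it is enough to test the generic element `(R.fst, R.snd)`. -/
theorem le_iff_mem {R S : Rel X Y} :
    R ≤ S ↔ ∀ ⦃W : C⦄ (x : W ⟶ X) (y : W ⟶ Y), R.Mem x y → S.Mem x y := by
  refine ⟨fun h _ _ _ hxy => factors_of_le _ h hxy, fun h => le_of_factors ?_⟩
  exact R.lift_fst_snd ▸ h _ _ R.mem_fst_snd

theorem mem_inf {R S : Rel X Y} {W : C} {x : W ⟶ X} {y : W ⟶ Y} :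
    Rel.Mem (R ⊓ S) x y ↔ R.Mem x y ∧ S.Mem x y :=
  inf_factors _

/-- Membership in a relation descends along strong epimorphisms. -/
theorem Mem.of_strongEpi {R : Rel X Y} {W W' : C} {x : W ⟶ X} {y : W ⟶ Y} (p : W' ⟶ W)
    [StrongEpi p] (h : R.Mem (p ≫ x) (p ≫ y)) : R.Mem x y := by
  rw [Mem] at h
  -- The strong epimorphism `p` is orthogonal to the monomorphism `R.arrow`; the diagonal filler is
  -- the required factorisation.
  have sq : CommSq (R.factorThru _ h) p R.arrow (prod.lift x y) :=
    ⟨by rw [factorThru_arrow, prod.comp_lift]⟩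
  rw [Mem, ← sq.fac_right]
  exact factors_comp_arrow _

theorem mem_opposite {R : Rel X Y} {W : C} {x : W ⟶ X} {y : W ⟶ Y} :
    R.opposite.Mem y x ↔ R.Mem x y := by
  constructor
  · intro h
    obtain ⟨k, hk⟩ : ∃ k : W ⟶ (R : C), k ≫ prod.lift R.snd R.fst = prod.lift y x := h
    rw [prod.comp_lift] at hk
    obtain ⟨rfl, rfl⟩ : k ≫ R.snd = y ∧ k ≫ R.fst = x :=
      ⟨by simpa only [prod.lift_fst] using congrArg (· ≫ prod.fst) hk,
        by simpa only [prod.lift_snd] using congrArg (· ≫ prod.snd) hk⟩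
    exact R.mem_fst_snd.precomp k
  · intro h
    obtain ⟨k, rfl, rfl⟩ := h.exists_lift
    exact ⟨k, prod.comp_lift _ _ _⟩

theorem isReflexive_iff {R : Rel X X} :
    R.IsReflexive ↔ ∀ ⦃W : C⦄ (x : W ⟶ X), R.Mem x x := by
  constructor
  · intro h W x
    exact factors_of_le _ h ⟨x, by simp [prod.comp_lift]⟩
  · intro h
    exact mk_le_of_comm (R.factorThru _ (h (𝟙 X))) (factorThru_arrow _ _ _)

theorem isSymmetric_iff {R : Rel X X} :
    R.IsSymmetric ↔ ∀ ⦃W : C⦄ (x y : W ⟶ X), R.Mem x y → R.Mem y x := by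
  rw [IsSymmetric, le_iff_mem]
  exact ⟨fun h W x y hxy => h y x (mem_opposite.2 hxy),
    fun h W x y hxy => h y x (mem_opposite.1 hxy)⟩

theorem Mem.comp {R : Rel X Y} {S : Rel Y Z} {W : C} {x : W ⟶ X} {y : W ⟶ Y} {z : W ⟶ Z}
    (hR : R.Mem x y) (hS : S.Mem y z) : (Rel.comp S R).Mem x z := by
  obtain ⟨k, rfl, rfl⟩ := hR.exists_lift
  obtain ⟨l, hl, rfl⟩ := hS.exists_lift
  have := imageSubobject_factors_comp_self
    (prod.lift (pullback.fst R.snd S.fst ≫ R.fst) (pullback.snd R.snd S.fst ≫ S.snd))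
    (pullback.lift k l hl.symm)
  rwa [prod.comp_lift, pullback.lift_fst_assoc, pullback.lift_snd_assoc] at this

/-- Elements related by a composite are linked by an intermediate element after passing to a cover
of their domain. -/
theorem Mem.exists_of_comp {R : Rel X Y} {S : Rel Y Z} {W : C} {x : W ⟶ X} {z : W ⟶ Z}
    (h : (Rel.comp S R).Mem x z) :
    ∃ (W' : C) (p : W' ⟶ W) (_ : StrongEpi p) (y : W' ⟶ Y),
      R.Mem (p ≫ x) y ∧ S.Mem y (p ≫ z) := by
  let f := prod.lift (pullback.fst R.snd S.fst ≫ R.fst) (pullback.snd R.snd S.fst ≫ S.snd)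
  obtain ⟨k, hk⟩ : ∃ k : W ⟶ image f, k ≫ image.ι f = prod.lift x z := h
  let e := factorThruImage f
  have : IsRegularEpi e := inferInstance
  have hf : pullback.fst k e ≫ prod.lift x z = pullback.snd k e ≫ f := by
    rw [← hk, pullback.condition_assoc, image.fac]
  have h₁ := congrArg (· ≫ prod.fst) hf
  have h₂ := congrArg (· ≫ prod.snd) hf
  simp only [Category.assoc, prod.lift_fst, prod.lift_snd, f] at h₁ h₂
  -- The cover is the pullback of the regular epimorphism `e` along `k`, hence again a regular
  -- epimorphism.
  refine ⟨_, pullback.fst k e, inferInstance,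
    pullback.snd k e ≫ pullback.fst R.snd S.fst ≫ R.snd, ?_, ?_⟩
  · rw [h₁]
    simpa only [Category.assoc] using
      R.mem_fst_snd.precomp (pullback.snd k e ≫ pullback.fst R.snd S.fst)
  · rw [h₂, pullback.condition]
    simpa only [Category.assoc] using
      S.mem_fst_snd.precomp (pullback.snd k e ≫ pullback.snd R.snd S.fst)

/-- The middle element of a composite is only local, but membership in `R` descends from the cover.
-/
theorem isTransitive_iff {R : Rel X X} :
    R.IsTransitive ↔
      ∀ ⦃W : C⦄ (x y z : W ⟶ X), R.Mem x y → R.Mem y z → R.Mem x z := by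
  rw [IsTransitive, le_iff_mem]
  refine ⟨fun h W x y z hxy hyz => h x z (hxy.comp hyz), fun h W x z hxz => ?_⟩
  obtain ⟨W', p, _, y, hxy, hyz⟩ := hxz.exists_of_comp
  exact .of_strongEpi p (h _ _ _ hxy hyz)

end Elements

section Equivalences

theorem IsEquivalence.of_mem {R : Rel X X} (refl : ∀ ⦃W : C⦄ (x : W ⟶ X), R.Mem x x)
    (symm : ∀ ⦃W : C⦄ (x y : W ⟶ X), R.Mem x y → R.Mem y x)
    (trans : ∀ ⦃W : C⦄ (x y z : W ⟶ X), R.Mem x y → R.Mem y z → R.Mem x z) :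
    R.IsEquivalence :=
  ⟨isReflexive_iff.2 refl, isSymmetric_iff.2 symm, isTransitive_iff.2 trans⟩

theorem IsEquivalence.mem_symm {R : Rel X X} (hR : R.IsEquivalence) {W : C} {x y : W ⟶ X}
    (h : R.Mem x y) : R.Mem y x :=
  isSymmetric_iff.1 hR.symm _ _ h

theorem IsEquivalence.mem_trans {R : Rel X X} (hR : R.IsEquivalence) {W : C} {x y z : W ⟶ X}
    (h : R.Mem x y) (h' : R.Mem y z) : R.Mem x z :=
  isTransitive_iff.1 hR.trans _ _ _ h h'

theorem IsEquivalence.inf {R S : Rel X X} (hR : R.IsEquivalence) (hS : S.IsEquivalence) :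
    Rel.IsEquivalence (R ⊓ S) := by
  refine .of_mem (fun W x => ?_) (fun W x y => ?_) (fun W x y z => ?_)
  · exact mem_inf.2 ⟨isReflexive_iff.1 hR.refl x, isReflexive_iff.1 hS.refl x⟩
  · simp only [mem_inf]
    exact fun h => ⟨hR.mem_symm h.1, hS.mem_symm h.2⟩
  · simp only [mem_inf]
    exact fun h h' => ⟨hR.mem_trans h.1 h'.1, hS.mem_trans h.2 h'.2⟩

/-- The inverse image of a relation along a morphism. -/
noncomputable def inverseImage (f : X ⟶ Y) (R : Rel Y Y) : Rel X X :=
  (Subobject.pullback (prod.map f f)).obj R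

theorem mem_inverseImage {f : X ⟶ Y} {R : Rel Y Y} {W : C} {x y : W ⟶ X} :
    (R.inverseImage f).Mem x y ↔ R.Mem (x ≫ f) (y ≫ f) := by
  rw [Mem, inverseImage, pullback_factors_iff, prod.lift_map, Mem]

theorem IsEquivalence.inverseImage {R : Rel Y Y} (hR : R.IsEquivalence) (f : X ⟶ Y) :
    (R.inverseImage f).IsEquivalence := by
  refine .of_mem (fun W x => ?_) (fun W x y => ?_) (fun W x y z => ?_) <;>
    simp only [mem_inverseImage]
  · exact isReflexive_iff.1 hR.refl _
  · exact hR.mem_symm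
  · exact hR.mem_trans

/-- The kernel pair of a morphism, as a relation on its domain. -/
noncomputable def kernelPair (f : X ⟶ Y) : Rel X X :=
  equalizerSubobject (prod.fst ≫ f) (prod.snd ≫ f)

theorem mem_kernelPair {f : X ⟶ Y} {W : C} {x y : W ⟶ X} :
    (kernelPair f).Mem x y ↔ x ≫ f = y ≫ f := by
  rw [Mem, kernelPair, equalizerSubobject_factors_iff, prod.lift_fst_assoc, prod.lift_snd_assoc]

theorem isEquivalence_kernelPair (f : X ⟶ Y) : (kernelPair f).IsEquivalence := by
  refine .of_mem (fun W x => ?_) (fun W x y => ?_) (fun W x y z => ?_) <;>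
    simp only [mem_kernelPair]
  · exact Eq.symm
  · exact Eq.trans

end Equivalences

end Rel

/-- In a Goursat category a chain `a R b S c R d` of equivalence relations can be replaced, after
passing to a cover, by a chain `a S b' R c' S d`. -/
theorem IsGoursat.exists_chain (hC : IsGoursat C) {R S : Rel X X} (hR : R.IsEquivalence)
    (hS : S.IsEquivalence) {W : C} {a b c d : W ⟶ X} (hab : R.Mem a b) (hbc : S.Mem b c)
    (hcd : R.Mem c d) :
    ∃ (W' : C) (p : W' ⟶ W) (_ : StrongEpi p) (b' c' : W' ⟶ X),
      S.Mem (p ≫ a) b' ∧ R.Mem b' c' ∧ S.Mem c' (p ≫ d) := by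
  have h : (Rel.comp R (Rel.comp S R)).Mem a d := (hab.comp hbc).comp hcd
  rw [hC X R S hR hS] at h
  obtain ⟨W₁, p, _, c₁, h₁, h₂⟩ := h.exists_of_comp
  obtain ⟨W₂, q, _, b₂, h₃, h₄⟩ := h₁.exists_of_comp
  refine ⟨W₂, q ≫ p, strongEpi_comp q p, b₂, q ≫ c₁, ?_, h₄, ?_⟩
  · rwa [Category.assoc]
  · rw [Category.assoc]
    exact h₂.precomp q

end RegularRel

open RegularRel Rel in
theorem proposition3p4 {C : Type u} [Category.{v} C] [Regular C] (hC : RegularRel.IsGoursat C)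
    {X : C} (R S T : RegularRel.Rel X X)
    (hR : R.IsEquivalence) (hS : S.IsReflexive) (hT : T.IsEquivalence)
    (hRST : R ⊓ S ≤ T)
    {W : C} (x y u v : W ⟶ X)
    (hxy : RegularRel.Rel.Mem (R ⊓ T) x y) (hxu : S.Mem x u) (hyv : S.Mem y v)
    (huv : R.Mem u v) :
    T.Mem u v := by
  -- On the object `S`: `(z, b) E (z', b')` iff `z (R ∧ T) z'` and `b R b'`; and `K` is the kernel
  -- pair of the second projection. The chain `(u, u) K (x, u) E (y, v) K (v, v)` is turned around.
  let E : Rel (S : C) (S : C) := (R ⊓ T).inverseImage S.fst ⊓ R.inverseImage S.snd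
  have hE : E.IsEquivalence := ((hR.inf hT).inverseImage _).inf (hR.inverseImage _)
  have memE {V : C} {s t : V ⟶ (S : C)} : E.Mem s t ↔
      (R.Mem (s ≫ S.fst) (t ≫ S.fst) ∧ T.Mem (s ≫ S.fst) (t ≫ S.fst)) ∧
        R.Mem (s ≫ S.snd) (t ≫ S.snd) := by
    simp only [E, mem_inf, mem_inverseImage]
  -- If `(a, a) E (z, b)`, then `z (R ∧ S) b`, so `a T b`.
  have key {V : C} {a : V ⟶ X} {s t : V ⟶ (S : C)} (h₁ : s ≫ S.fst = a) (h₂ : s ≫ S.snd = a)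
      (h : E.Mem s t) : T.Mem a (t ≫ S.snd) := by
    obtain ⟨⟨hR₁, hT₁⟩, hR₂⟩ := memE.1 h
    rw [h₁] at hR₁ hT₁
    rw [h₂] at hR₂
    exact hT.mem_trans hT₁ (le_iff_mem.1 hRST _ _
      (mem_inf.2 ⟨hR.mem_trans (hR.mem_symm hR₁) hR₂, S.mem_fst_snd.precomp t⟩))
  obtain ⟨uu, huu₁, huu₂⟩ := (isReflexive_iff.1 hS u).exists_lift
  obtain ⟨vv, hvv₁, hvv₂⟩ := (isReflexive_iff.1 hS v).exists_lift
  obtain ⟨xu, hxu₁, hxu₂⟩ := hxu.exists_lift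
  obtain ⟨yv, hyv₁, hyv₂⟩ := hyv.exists_lift
  -- After the exchange `E` occupies the outer links, which start and end at the diagonal pairs, as
  -- `key` requires.
  obtain ⟨W', p, _, s, t, hs, hst, ht⟩ := hC.exists_chain (isEquivalence_kernelPair S.snd) hE
    (a := uu) (b := xu) (c := yv) (d := vv)
    (mem_kernelPair.2 (huu₂.trans hxu₂.symm))
    (memE.2 (by rw [hxu₁, hxu₂, hyv₁, hyv₂]; exact ⟨mem_inf.1 hxy, huv⟩))
    (mem_kernelPair.2 (hyv₂.trans hvv₂.symm))
  have hu : T.Mem (p ≫ u) (s ≫ S.snd) :=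
    key (by rw [Category.assoc, huu₁]) (by rw [Category.assoc, huu₂]) hs
  have hv : T.Mem (p ≫ v) (t ≫ S.snd) :=
    key (by rw [Category.assoc, hvv₁]) (by rw [Category.assoc, hvv₂]) (hE.mem_symm ht)
  -- The middle link identifies the second components of `s` and `t`.
  rw [← mem_kernelPair.1 hst] at hv
  exact .of_strongEpi p (hT.mem_trans hu (hT.mem_symm hv))
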